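/- Every odd positive integer $n$ distinct from $1, 3, 5$ and $9$ satisfies Robin's inequality $$\sigma(n) < e^{\gamma}\, n \log\log n,$$ where $\sigma(n)=\sum_{d\mid n} d$ is the sum of the positive divisors of $n$ and $\gamma$ is the Euler(-Mascheroni) constant. -/

import Mathlib

/-- Robin's inequality `σ(n) < e^γ n log log n`, where `σ(n)` is the sum of the positive divisors
of `n` and `γ` is Euler's constant. -/
def RobinInequality (n : ℕ) : Prop :=
  (ArithmeticFunction.sigma 1 n : ℝ) <
    Real.exp Real.eulerMascheroniConstant * n * Real.log (Real.log n)

/-- The set of integers `n ≥ 1` that satisfy Robin's inequality. -/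
def robinSet : Set ℕ := {n | 1 ≤ n ∧ RobinInequality n}

/-- The product `∏ p / (p - 1)` over a finite set of natural numbers. -/
noncomputable def eulerProd (S : Finset ℕ) : ℝ := ∏ p ∈ S, (p : ℝ) / (p - 1)

/-! Since σ(n)/n ≤ ∏_{p∣n} p/(p-1) and e^γ > 1.74, it is enough to bound this product by 1.74 log
log n. For odd n the factor 2 at p = 2 is missing, which leaves enough slack for crude Mertens and
Chebyshev bounds.

For y = log n ≥ 10, split the primes at y (`eulerProd_primeFactors_le`). Those up to y give at most
the product over all odd primes ≤ y; at most y/log y exceed y, so they give a factor near 1. The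
first product is bounded by `eulerProd_erase_two_primesLE_le` for y ≥ 128, by tables below. For y <
10, n has at most five prime factors, and `prod_and_eulerProd_of_odd` compares them with 3, 5, 7, 9,
11. The n < 21 are checked singly. -/

/-! ### Rational bounds for e^(a/b), via b-th powers, and for e^γ. -/

theorem exp_div_le {a b : ℕ} {r : ℝ} (hb : b ≠ 0) (hr : 0 ≤ r)
    (h : (2.7182818286 : ℝ) ^ a ≤ r ^ b) : Real.exp (a / b) ≤ r := by
  refine le_of_pow_le_pow_left₀ hb hr ?_
  rw [← Real.exp_nat_mul, mul_div_cancel₀ _ (by exact_mod_cast hb)]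
  calc Real.exp a = Real.exp 1 ^ a := by rw [← Real.exp_nat_mul, mul_one]
    _ ≤ 2.7182818286 ^ a := pow_le_pow_left₀ (Real.exp_pos _).le Real.exp_one_lt_d9.le _
    _ ≤ r ^ b := h

theorem le_exp_div {a b : ℕ} {r : ℝ} (hb : b ≠ 0)
    (h : r ^ b ≤ (2.7182818283 : ℝ) ^ a) : r ≤ Real.exp (a / b) := by
  refine le_of_pow_le_pow_left₀ hb (Real.exp_pos _).le ?_
  rw [← Real.exp_nat_mul, mul_div_cancel₀ _ (by exact_mod_cast hb)]
  calc r ^ b ≤ 2.7182818283 ^ a := h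
    _ ≤ Real.exp 1 ^ a := pow_le_pow_left₀ (by norm_num) Real.exp_one_gt_d9.le _
    _ = Real.exp a := by rw [← Real.exp_nat_mul, mul_one]

theorem exp_eulerMascheroni_gt : 1.74 < Real.exp Real.eulerMascheroniConstant := by
  have h1 : (33 : ℝ) ≤ Real.exp ((7 : ℕ) / (2 : ℕ)) := le_exp_div (by norm_num) (by norm_num)
  have h2 : Real.log 33 ≤ 7 / 2 := by
    rw [Real.log_le_iff_le_exp (by norm_num)]; exact_mod_cast h1
  have h3 := Real.eulerMascheroniSeq_lt_eulerMascheroniConstant 32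
  -- H_32 - log 33 increases to γ's side from below; H_32 ≈ 4.0585 and log 33 ≤ 3.5 leave just over
  -- 5/9.
  have h4 : (5 : ℝ) / 9 < Real.eulerMascheroniConstant := by
    refine lt_trans ?_ h3
    have : (harmonic 32 : ℚ) > 5 / 9 + 7 / 2 := by
      norm_num [harmonic, Finset.sum_range_succ]
    have h5 : ((5 / 9 + 7 / 2 : ℚ) : ℝ) < (harmonic 32 : ℚ) := by exact_mod_cast this
    rw [Real.eulerMascheroniSeq]
    push_cast at h5 ⊢
    norm_num at h5 ⊢
    linarith
  have h6 : (1.74 : ℝ) ≤ Real.exp ((5 : ℕ) / (9 : ℕ)) := le_exp_div (by norm_num) (by norm_num)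
  refine lt_of_le_of_lt h6 (Real.exp_lt_exp.2 ?_)
  exact_mod_cast h4

/-! ### Reduction to Euler products. -/

theorem sigma_one_le_mul_eulerProd {n : ℕ} (hn : n ≠ 0) :
    (ArithmeticFunction.sigma 1 n : ℝ) ≤ eulerProd n.primeFactors * n := by
  have h1 : (n : ℝ) = ∏ p ∈ n.primeFactors, (p : ℝ) ^ n.factorization p := by
    conv_lhs => rw [← Nat.prod_factorization_pow_eq_self hn]
    rw [Finsupp.prod]; push_cast; rfl
  rw [ArithmeticFunction.sigma_eq_prod_primeFactors_sum_range_factorization_pow_mul hn]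
  conv_rhs => rw [h1]
  rw [eulerProd, ← Finset.prod_mul_distrib]
  push_cast
  refine Finset.prod_le_prod (fun p _ => by positivity) fun p hp => ?_
  have hp2 : (2 : ℝ) ≤ p := by exact_mod_cast (Nat.prime_of_mem_primeFactors hp).two_le
  have := geom_sum_eq (x := (p : ℝ)) (by linarith) (n.factorization p + 1)
  simp only [mul_one]
  rw [this, div_mul_eq_mul_div, pow_succ]
  gcongr
  · linarith
  · nlinarith

/-- The chain e^t ≤ u, e^u ≤ n certifies t ≤ log log n, so with rational t and u only exponentials
need estimating. -/
theorem robinInequality_of_le {n : ℕ} {s t u : ℝ} (hn : 0 < n)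
    (hs : (ArithmeticFunction.sigma 1 n : ℝ) ≤ s * n) (hu : Real.exp u ≤ n) (ht : Real.exp t ≤ u)
    (ht0 : 0 ≤ t) (hst : s < 1.74 * t) : RobinInequality n := by
  have hn' : (0 : ℝ) < n := by exact_mod_cast hn
  have hu' : u ≤ Real.log n := (Real.le_log_iff_exp_le hn').2 hu
  have h0 : 0 < u := (Real.exp_pos t).trans_le ht
  have ht' : t ≤ Real.log (Real.log n) :=
    (Real.le_log_iff_exp_le (h0.trans_le hu')).2 (ht.trans hu')
  have hg := exp_eulerMascheroni_gt
  calc (ArithmeticFunction.sigma 1 n : ℝ) ≤ s * n := hs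
    _ < 1.74 * t * n := by gcongr
    _ ≤ Real.exp Real.eulerMascheroniConstant * Real.log (Real.log n) * n := by gcongr
    _ = _ := by ring

theorem eulerProd_nonneg {S : Finset ℕ} (hS : ∀ p ∈ S, 2 ≤ p) : 0 ≤ eulerProd S :=
  Finset.prod_nonneg fun p hp => div_nonneg (by positivity) (by
    have : (2 : ℝ) ≤ p := by exact_mod_cast hS p hp
    linarith)

theorem one_le_div_sub_one {p : ℕ} (hp : 2 ≤ p) : 1 ≤ (p : ℝ) / (p - 1) := by
  have : (2 : ℝ) ≤ p := by exact_mod_cast hp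
  rw [one_le_div (by linarith)]; linarith

theorem eulerProd_mono {S T : Finset ℕ} (h : S ⊆ T) (hT : ∀ p ∈ T, 2 ≤ p) :
    eulerProd S ≤ eulerProd T := by
  rw [eulerProd, eulerProd, ← Finset.prod_sdiff h]
  refine le_mul_of_one_le_left (eulerProd_nonneg fun p hp => hT p (h hp)) ?_
  exact Finset.one_le_prod fun p hp => one_le_div_sub_one (hT p (Finset.mem_sdiff.1 hp).1)

theorem eulerProd_le_exp_sum {S : Finset ℕ} (hS : ∀ p ∈ S, 2 ≤ p) :
    eulerProd S ≤ Real.exp (∑ p ∈ S, 1 / ((p : ℝ) - 1)) := by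
  rw [Real.exp_sum]
  refine Finset.prod_le_prod (fun p hp => zero_le_one.trans (one_le_div_sub_one (hS p hp)))
    fun p hp => ?_
  have : (2 : ℝ) ≤ p := by exact_mod_cast hS p hp
  refine le_trans (le_of_eq ?_) (Real.add_one_le_exp _)
  have : (p : ℝ) - 1 ≠ 0 := by linarith
  field_simp; ring

/-- Among sets of `k` odd numbers greater than one, `{3, 5, …, 2 k + 1}` has the least product and
the greatest Euler product. -/
theorem prod_and_eulerProd_of_odd (k : ℕ) (S : Finset ℕ) (hS : ∀ p ∈ S, Odd p ∧ 3 ≤ p)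
    (hk : S.card = k) :
    ∏ i ∈ Finset.range k, (2 * i + 3) ≤ ∏ p ∈ S, p ∧
      eulerProd S ≤ ∏ i ∈ Finset.range k, ((2 * i + 3 : ℝ) / (2 * i + 2)) := by
  induction k generalizing S with
  | zero => simp [Finset.card_eq_zero.1 hk, eulerProd]
  | succ k ih =>
    have hne : S.Nonempty := Finset.card_pos.1 (by omega)
    set m := S.max' hne with hm
    have hmS : m ∈ S := S.max'_mem hne
    -- The k + 1 elements are distinct odd numbers in [3, m].
    have hge : 2 * k + 3 ≤ m := by
      have hsub : S ⊆ (Finset.Icc 1 ((m - 1) / 2)).image fun i => 2 * i + 1 := by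
        intro p hp
        obtain ⟨⟨j, rfl⟩, h3⟩ := hS p hp
        have := S.le_max' _ hp
        refine Finset.mem_image.2 ⟨j, ?_, rfl⟩
        rw [Finset.mem_Icc]; omega
      have := (Finset.card_le_card hsub).trans Finset.card_image_le
      rw [Nat.card_Icc, hk] at this
      have := (hS m hmS).2
      omega
    obtain ⟨h1, h2⟩ := ih (S.erase m) (fun p hp => hS p (Finset.mem_of_mem_erase hp))
      (by rw [Finset.card_erase_of_mem hmS, hk]; rfl)
    rw [Finset.prod_range_succ, Finset.prod_range_succ, eulerProd, ← Finset.prod_erase_mul _ _ hmS,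
      ← Finset.prod_erase_mul _ _ hmS]
    refine ⟨Nat.mul_le_mul h1 hge, ?_⟩
    have hge' : (2 * k + 3 : ℝ) ≤ m := by exact_mod_cast hge
    have hk0 : (0 : ℝ) ≤ k := by positivity
    refine mul_le_mul h2 ?_ (zero_le_one.trans (one_le_div_sub_one (by omega)))
      (Finset.prod_nonneg fun i _ => by positivity)
    rw [div_le_div_iff₀ (by linarith) (by linarith)]
    nlinarith

/-! ### Upper bounds in Mertens' theorems. -/

theorem log_factorial_le {n : ℕ} (hn : 1 ≤ n) :
    Real.log n.factorial ≤ n * Real.log n - n + Real.log n + 1 := by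
  induction n, hn using Nat.le_induction with
  | base => simp
  | succ n hn ih =>
    have hn' : (1 : ℝ) ≤ n := by exact_mod_cast hn
    have h1 : Real.log n ≤ Real.log (n + 1) - 1 / (n + 1) := by
      have := Real.log_le_sub_one_of_pos (x := (n : ℝ) / (n + 1)) (by positivity)
      rw [Real.log_div (by positivity) (by positivity)] at this
      have h2 : (n : ℝ) / (n + 1) - 1 = - (1 / (n + 1)) := by field_simp; ring
      linarith
    rw [Nat.factorial_succ]
    push_cast
    rw [Real.log_mul (by positivity) (by positivity)]
    have h3 : (n + 1) * Real.log n ≤ (n + 1) * Real.log (n + 1) - 1 := by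
      have := mul_le_mul_of_nonneg_left h1 (by positivity : (0 : ℝ) ≤ n + 1)
      have h4 : ((n : ℝ) + 1) * (1 / (n + 1)) = 1 := by field_simp
      linarith
    linarith

/-- ⌊N/p⌋ counts the multiples of p up to N; swapping sums reduces the claim to rad(m) ≤ m for each
m ≤ N. -/
theorem sum_log_mul_div_le_log_factorial (N : ℕ) :
    ∑ p ∈ N.primesLE, Real.log p * (N / p : ℕ) ≤ Real.log N.factorial := by
  have h1 : Real.log N.factorial = ∑ m ∈ Finset.Ioc 0 N, Real.log m := by
    induction N with
    | zero => simp
    | succ n ih =>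
      rw [Nat.factorial_succ, Finset.sum_Ioc_succ_top (Nat.zero_le n), ← ih, Nat.cast_mul,
        Real.log_mul (by positivity) (by positivity), add_comm]
  have h2 : ∀ p ∈ N.primesLE, Real.log p * (N / p : ℕ) =
      ∑ m ∈ Finset.Ioc 0 N, if p ∣ m then Real.log p else 0 := by
    intro p _
    rw [← Finset.sum_filter, Finset.sum_const, Nat.Ioc_filter_dvd_card_eq_div, nsmul_eq_mul,
      mul_comm]
  rw [h1, Finset.sum_congr rfl h2, Finset.sum_comm]
  refine Finset.sum_le_sum fun m hm => ?_
  obtain ⟨hm0, hmN⟩ := Finset.mem_Ioc.1 hm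
  have h3 : N.primesLE.filter (· ∣ m) = m.primeFactors := by
    ext p
    simp only [Finset.mem_filter, Nat.mem_primesLE, Nat.mem_primeFactors]
    constructor
    · rintro ⟨⟨_, hp⟩, hd⟩
      exact ⟨hp, hd, hm0.ne'⟩
    · rintro ⟨hp, hd, _⟩
      exact ⟨⟨(Nat.le_of_dvd hm0 hd).trans hmN, hp⟩, hd⟩
  rw [← Finset.sum_filter, h3, ← Real.log_prod (fun p hp => by
    have := (Nat.prime_of_mem_primeFactors hp).pos
    positivity), ← Nat.cast_prod]
  have h4 : 0 < ∏ p ∈ m.primeFactors, p :=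
    Finset.prod_pos fun p hp => (Nat.prime_of_mem_primeFactors hp).pos
  exact Real.log_le_log (by exact_mod_cast h4)
    (by exact_mod_cast Nat.le_of_dvd hm0 m.prod_primeFactors_dvd)

/-- Upper bound in Mertens' first theorem. -/
theorem sum_log_div_primesLE_le {N : ℕ} (hN : 1 ≤ N) :
    ∑ p ∈ N.primesLE, Real.log p / p ≤
      Real.log N + (Real.log 4 - 1 + (Real.log N + 1) / N) := by
  have hN' : (0 : ℝ) < N := by exact_mod_cast hN
  have h1 : N * ∑ p ∈ N.primesLE, Real.log p / p ≤
      ∑ p ∈ N.primesLE, Real.log p * (N / p : ℕ) + ∑ p ∈ N.primesLE, Real.log p := by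
    rw [Finset.mul_sum, ← Finset.sum_add_distrib]
    refine Finset.sum_le_sum fun p hp => ?_
    have hp0 : (0 : ℝ) < p := by exact_mod_cast (Nat.prime_of_mem_primesLE hp).pos
    -- Dropping the floors costs at most θ(N) ≤ N log 4 in total.
    have h2 : (N : ℝ) / p ≤ (N / p : ℕ) + 1 := by
      rw [← Nat.floor_div_eq_div (K := ℝ)]; exact (Nat.lt_floor_add_one _).le
    have h3 := mul_le_mul_of_nonneg_left h2 (Real.log_natCast_nonneg p)
    calc N * (Real.log p / p) = Real.log p * (N / p) := by ring
      _ ≤ _ := by linarith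
  have h4 := sum_log_mul_div_le_log_factorial N
  have h5 := Chebyshev.theta_le_log4_mul_x hN'.le
  rw [Chebyshev.theta_eq_sum_primesLE_log] at h5
  have h6 := log_factorial_le hN
  refine le_of_mul_le_mul_left ?_ hN'
  have h7 : N * (Real.log N + (Real.log 4 - 1 + (Real.log N + 1) / N)) =
    N * Real.log N + N * Real.log 4 - N + Real.log N + 1 := by field_simp; ring
  linarith

/-- A discrete partial summation giving the upper bound in Mertens' second theorem, starting from
the upper bound `log n + c` in the first. -/
theorem sum_inv_primesLE_le {c : ℝ} {m : ℕ} (hm : 2 ≤ m)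
    (hc : ∀ n : ℕ, m ≤ n → ∑ p ∈ n.primesLE, Real.log p / p ≤ Real.log n + c) {N : ℕ}
    (hN : m ≤ N) :
    ∑ p ∈ N.primesLE, 1 / (p : ℝ) ≤ ∑ p ∈ m.primesLE, 1 / (p : ℝ) +
      (Real.log (Real.log N) - Real.log (Real.log m)) +
      (Real.log m + c - ∑ p ∈ m.primesLE, Real.log p / p) / Real.log m := by
  -- Keeping the nonnegative boundary term of the partial summation makes the induction close.
  suffices h : ∑ p ∈ N.primesLE, 1 / (p : ℝ) ≤ ∑ p ∈ m.primesLE, 1 / (p : ℝ) +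
      (Real.log (Real.log N) - Real.log (Real.log m)) +
      (Real.log m + c - ∑ p ∈ m.primesLE, Real.log p / p) / Real.log m -
      (Real.log N + c - ∑ p ∈ N.primesLE, Real.log p / p) / Real.log N by
    have h1 : 0 ≤ (Real.log N + c - ∑ p ∈ N.primesLE, Real.log p / p) / Real.log N :=
      div_nonneg (by linarith [hc N hN]) (Real.log_natCast_nonneg N)
    linarith
  induction N, hN using Nat.le_induction with
  | base => simp
  | succ n hn ih =>
    have hn2 : (2 : ℝ) ≤ n := by exact_mod_cast hm.trans hn
    have hl0 : 0 < Real.log n := Real.log_pos (by linarith)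
    have hl1 : Real.log n < Real.log (n + 1 : ℕ) :=
      Real.log_lt_log (by linarith) (by push_cast; linarith)
    set l := Real.log n
    set l' := Real.log (n + 1 : ℕ)
    have hl' : 0 < l' := hl0.trans hl1
    set A := ∑ p ∈ n.primesLE, Real.log p / p
    have hlog : 1 - l / l' ≤ Real.log l' - Real.log l := by
      have := Real.log_le_sub_one_of_pos (x := l / l') (by positivity)
      rw [Real.log_div hl0.ne' hl'.ne'] at this
      linarith
    have hD : 0 ≤ l + c - A := by linarith [hc n hn]
    have hmono : (l + c - A) / l' ≤ (l + c - A) / l := by gcongr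
    have e1 : (l' + c - A) / l' = (l + c - A) / l' + (1 - l / l') := by field_simp; ring
    by_cases hp : (n + 1).Prime
    · have hs : ∀ f : ℕ → ℝ, ∑ p ∈ (n + 1).primesLE, f p = ∑ p ∈ n.primesLE, f p + f (n + 1) := by
        intro f
        rw [Nat.primesLE_succ, if_pos hp, Finset.sum_insert (Nat.notMem_primesLE n), add_comm]
      rw [hs, hs]
      have e2 : (l' + c - (A + l' / (n + 1 : ℕ))) / l' = (l' + c - A) / l' - 1 / (n + 1 : ℕ) := by
        field_simp
        ring
      rw [e2]
      linarith
    · rw [Nat.primesLE_succ, if_neg hp]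
      linarith

/-! ### Numerical data at 128 and the explicit third theorem. -/

theorem primesLE_128 : Nat.primesLE 128 = {2, 3, 5, 7, 11, 13, 17, 19, 23, 29, 31, 37, 41, 43, 47,
    53, 59, 61, 67, 71, 73, 79, 83, 89, 97, 101, 103, 107, 109, 113, 127} := by
  decide +kernel

/-- Rounds log₂ p down to a quarter-integer, so that sums of log p / p become rational multiples of
log 2. -/
theorem log_ge_natLog_mul_log_two (p : ℕ) (hp : p ≠ 0) :
    (Nat.log 2 (p ^ 4) : ℝ) / 4 * Real.log 2 ≤ Real.log p := by
  have h := Nat.pow_log_le_self 2 (pow_ne_zero 4 hp)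
  have h1 : (2 : ℝ) ^ Nat.log 2 (p ^ 4) ≤ (p : ℝ) ^ 4 := by exact_mod_cast h
  have h2 := Real.log_le_log (by positivity) h1
  rw [Real.log_pow, Real.log_pow] at h2
  push_cast at h2
  linarith

theorem sum_log_div_primesLE_128_ge :
    5.07 * Real.log 2 ≤ ∑ p ∈ Nat.primesLE 128, Real.log p / p := by
  calc 5.07 * Real.log 2 ≤
      (∑ p ∈ Nat.primesLE 128, (Nat.log 2 (p ^ 4) : ℝ) / 4 / p) * Real.log 2 := by
        refine mul_le_mul_of_nonneg_right ?_ (Real.log_nonneg (by norm_num))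
        rw [primesLE_128]
        norm_num
    _ ≤ _ := by
        rw [Finset.sum_mul]
        refine Finset.sum_le_sum fun p hp => ?_
        rw [div_mul_eq_mul_div]
        gcongr
        exact log_ge_natLog_mul_log_two p (Nat.prime_of_mem_primesLE hp).ne_zero

theorem eulerProd_erase_two_primesLE_128 :
    eulerProd ((Nat.primesLE 128).erase 2) ≤ 4.392 := by
  have : (Nat.primesLE 128).erase 2 = {3, 5, 7, 11, 13, 17, 19, 23, 29, 31, 37, 41, 43, 47,
    53, 59, 61, 67, 71, 73, 79, 83, 89, 97, 101, 103, 107, 109, 113, 127} := by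
    rw [primesLE_128]; decide
  rw [this, eulerProd]
  norm_num

theorem sum_Ioc_inv_mul_sub_one_le {m N : ℕ} (hm : 1 ≤ m) (hN : m ≤ N) :
    ∑ k ∈ Finset.Ioc m N, (1 / ((k : ℝ) - 1) - 1 / k) ≤ 1 / m := by
  suffices h : ∑ k ∈ Finset.Ioc m N, (1 / ((k : ℝ) - 1) - 1 / k) = 1 / m - 1 / N by
    rw [h]
    have : (0 : ℝ) ≤ 1 / N := by positivity
    linarith
  induction N, hN using Nat.le_induction with
  | base => simp
  | succ n hn ih => rw [Finset.sum_Ioc_succ_top hn, ih]; push_cast; ring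

/-- Uses p/(p-1) ≤ e^(1/(p-1)); replacing 1/(p-1) by 1/p costs a telescoping sum of at most 1/m. -/
theorem eulerProd_sdiff_primesLE_le {m N : ℕ} (hm : 1 ≤ m) (hN : m ≤ N) :
    eulerProd (N.primesLE \ m.primesLE) ≤ Real.exp
      (∑ p ∈ N.primesLE, 1 / (p : ℝ) - ∑ p ∈ m.primesLE, 1 / (p : ℝ) + 1 / m) := by
  refine (eulerProd_le_exp_sum fun p hp =>
    (Nat.prime_of_mem_primesLE (Finset.mem_sdiff.1 hp).1).two_le).trans ?_
  rw [Real.exp_le_exp, ← Finset.sum_sdiff (Nat.primesLE_mono hN), add_sub_cancel_right]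
  have hsub : N.primesLE \ m.primesLE ⊆ Finset.Ioc m N := by
    intro p hp
    rw [Finset.mem_sdiff, Nat.mem_primesLE, Nat.mem_primesLE] at hp
    rw [Finset.mem_Ioc]
    exact ⟨not_le.1 fun h => hp.2 ⟨h, hp.1.2⟩, hp.1.1⟩
  have h1 : ∑ p ∈ N.primesLE \ m.primesLE, (1 / ((p : ℝ) - 1) - 1 / p) ≤ 1 / m := by
    refine (Finset.sum_le_sum_of_subset_of_nonneg hsub fun k hk _ => ?_).trans
      (sum_Ioc_inv_mul_sub_one_le hm hN)
    have : (2 : ℝ) ≤ k := by exact_mod_cast (Finset.mem_Ioc.1 hk).1.trans_le' (by omega)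
    rw [sub_nonneg]
    exact one_div_le_one_div_of_le (by linarith) (by linarith)
  rw [Finset.sum_sub_distrib] at h1
  linarith

/-- A weak explicit form of Mertens' third theorem. -/
theorem eulerProd_erase_two_primesLE_le {N : ℕ} (hN : 128 ≤ N) :
    eulerProd (N.primesLE.erase 2) ≤ 1.33 * Real.log N := by
  have hl1 := Real.log_two_gt_d9
  have hl2 := Real.log_two_lt_d9
  have h128 : Real.log (128 : ℕ) = 7 * Real.log 2 := by
    rw [show ((128 : ℕ) : ℝ) = 2 ^ 7 by norm_num, Real.log_pow]; norm_num
  have h4 : Real.log 4 = 2 * Real.log 2 := by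
    rw [show (4 : ℝ) = 2 ^ 2 by norm_num, Real.log_pow]; norm_num
  set l := Real.log 2
  have hlN : 7 * l ≤ Real.log N := by
    rw [← h128]; exact Real.log_le_log (by norm_num) (by exact_mod_cast hN)
  have hc : ∀ n : ℕ, 128 ≤ n → ∑ p ∈ n.primesLE, Real.log p / p ≤
      Real.log n + (2 * l - 1 + (7 * l + 1) / 128) := by
    intro n hn
    have hn' : (128 : ℝ) ≤ n := by exact_mod_cast hn
    have h1 := sum_log_div_primesLE_le (N := n) (by omega)
    -- The tangent to log at 128 shows that (log n + 1)/n is largest at n = 128.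
    have h2 : Real.log n - 7 * l ≤ n / 128 - 1 := by
      rw [← h128, ← Real.log_div (by positivity) (by norm_num)]
      exact_mod_cast Real.log_le_sub_one_of_pos (x := (n : ℝ) / 128) (by positivity)
    have h3 : (Real.log n + 1) / n ≤ (7 * l + 1) / 128 := by
      rw [div_le_div_iff₀ (by positivity) (by norm_num)]
      nlinarith
    rw [h4] at h1
    linarith
  have h1 := sum_inv_primesLE_le (by norm_num) hc hN
  have h2 := eulerProd_sdiff_primesLE_le (by norm_num) hN
  have h3 : (Real.log (128 : ℕ) + (2 * l - 1 + (7 * l + 1) / 128) -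
      ∑ p ∈ Nat.primesLE 128, Real.log p / p) / Real.log (128 : ℕ) + 1 / (128 : ℕ) ≤ 3 / 8 := by
    rw [h128, ← le_sub_iff_add_le, div_le_iff₀ (by linarith)]
    have := sum_log_div_primesLE_128_ge
    push_cast
    linarith
  have h5 : Real.exp ((3 : ℕ) / (8 : ℕ)) ≤ 1.46 :=
    exp_div_le (by norm_num) (by norm_num) (by norm_num)
  push_cast at h5
  have hsplit : eulerProd (N.primesLE.erase 2) =
      eulerProd (N.primesLE \ Nat.primesLE 128) * eulerProd ((Nat.primesLE 128).erase 2) := by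
    rw [eulerProd, eulerProd, eulerProd,
      ← Finset.prod_sdiff (Finset.erase_subset_erase 2 (Nat.primesLE_mono hN))]
    congr 1
    refine Finset.prod_congr ?_ fun _ _ => rfl
    ext p
    have : 2 ∈ Nat.primesLE 128 := Nat.mem_primesLE.2 ⟨by norm_num, Nat.prime_two⟩
    simp only [Finset.mem_sdiff, Finset.mem_erase]
    grind
  have h6 : eulerProd (N.primesLE \ Nat.primesLE 128) ≤ Real.log N / (7 * l) * 1.46 := by
    refine h2.trans ?_
    have h7 : Real.log N / (7 * l) =
        Real.exp (Real.log (Real.log N) - Real.log (Real.log (128 : ℕ))) := by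
      rw [Real.exp_sub, Real.exp_log (by linarith), h128, Real.exp_log (by linarith)]
    refine le_trans ?_ (mul_le_mul_of_nonneg_left h5 (by positivity))
    rw [h7, ← Real.exp_add, Real.exp_le_exp]
    linarith
  rw [hsplit]
  calc _ ≤ Real.log N / (7 * l) * 1.46 * 4.392 :=
        mul_le_mul h6 eulerProd_erase_two_primesLE_128 (eulerProd_nonneg fun p hp =>
          (Nat.prime_of_mem_primesLE (Finset.mem_of_mem_erase hp)).two_le) (by positivity)
    _ = Real.log N * (1.46 * 4.392 / (7 * l)) := by ring
    _ ≤ Real.log N * 1.33 := by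
        refine mul_le_mul_of_nonneg_left ?_ (by linarith)
        rw [div_le_iff₀ (by linarith)]
        linarith
    _ = _ := mul_comm _ _

/-! ### Large n: splitting the primes at log n. -/

theorem eulerProd_primeFactors_le {n : ℕ} (hodd : Odd n) {y : ℝ} (hy : 1 < y)
    (hlog : y = Real.log n) :
    eulerProd n.primeFactors ≤
      eulerProd ((Nat.primesLE ⌊y⌋₊).erase 2) * Real.exp (y / ((y - 1) * Real.log y)) := by
  have h0 : n ≠ 0 := by rintro rfl; simp at hodd
  have hly : 0 < Real.log y := Real.log_pos hy
  have h2 : ∀ p ∈ n.primeFactors, 2 ≤ p := fun p hp => (Nat.prime_of_mem_primeFactors hp).two_le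
  rw [eulerProd, ← Finset.prod_filter_mul_prod_filter_not _ (fun p => p ≤ ⌊y⌋₊)]
  refine mul_le_mul ?_ ?_ (eulerProd_nonneg fun p hp => h2 p (Finset.mem_filter.1 hp).1)
    (eulerProd_nonneg fun p hp =>
      (Nat.prime_of_mem_primesLE (Finset.mem_of_mem_erase hp)).two_le)
  · refine eulerProd_mono (fun p hp => ?_) fun p hp =>
      (Nat.prime_of_mem_primesLE (Finset.mem_of_mem_erase hp)).two_le
    obtain ⟨hp1, hp2⟩ := Finset.mem_filter.1 hp
    refine Finset.mem_erase.2
      ⟨?_, Nat.mem_primesLE.2 ⟨hp2, Nat.prime_of_mem_primeFactors hp1⟩⟩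
    rintro rfl
    exact (Nat.not_even_iff_odd.2 hodd) (even_iff_two_dvd.2 (Nat.dvd_of_mem_primeFactors hp1))
  · set S := n.primeFactors.filter fun p => ¬ p ≤ ⌊y⌋₊ with hS
    have hSy : ∀ p ∈ S, y < p := fun p hp =>
      (Nat.floor_lt (by linarith)).1 (not_le.1 (Finset.mem_filter.1 hp).2)
    refine (eulerProd_le_exp_sum fun p hp => h2 p (Finset.mem_filter.1 hp).1).trans ?_
    rw [Real.exp_le_exp]
    -- Each prime in S exceeds y, while the product of all primes dividing n is at most n = e^y.
    have hcard : S.card * Real.log y ≤ y := by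
      calc S.card * Real.log y = ∑ p ∈ S, Real.log y := by rw [Finset.sum_const, nsmul_eq_mul]
        _ ≤ ∑ p ∈ S, Real.log p := Finset.sum_le_sum fun p hp =>
            Real.log_le_log (by linarith) (hSy p hp).le
        _ ≤ ∑ p ∈ n.primeFactors, Real.log p :=
            Finset.sum_le_sum_of_subset_of_nonneg (Finset.filter_subset _ _)
              fun p _ _ => Real.log_natCast_nonneg p
        _ = Real.log (∏ p ∈ n.primeFactors, p : ℕ) := by
            rw [Nat.cast_prod, Real.log_prod]
            intro p hp
            have := h2 p hp
            positivity
        _ ≤ Real.log n := Real.log_le_log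
            (by exact_mod_cast Finset.prod_pos fun p hp => (Nat.prime_of_mem_primeFactors hp).pos)
            (by exact_mod_cast Nat.le_of_dvd (Nat.pos_of_ne_zero h0) n.prod_primeFactors_dvd)
        _ = y := hlog.symm
    calc ∑ p ∈ S, 1 / ((p : ℝ) - 1) ≤ ∑ p ∈ S, 1 / (y - 1) := Finset.sum_le_sum fun p hp =>
          one_div_le_one_div_of_le (by linarith) (by linarith [hSy p hp])
      _ = S.card / (y - 1) := by rw [Finset.sum_const, nsmul_eq_mul, mul_one_div]
      _ ≤ y / Real.log y / (y - 1) := by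
          rw [← le_div_iff₀ hly] at hcard
          exact div_le_div_of_nonneg_right hcard (by linarith)
      _ = _ := by rw [div_div, mul_comm (y - 1)]

theorem div_sub_one_mul_log_le {a t y : ℝ} (ha : 1 < a) (hay : a ≤ y) (ht : 0 < t)
    (hty : t ≤ Real.log y) : y / ((y - 1) * Real.log y) ≤ a / ((a - 1) * t) := by
  have h1 : y / (y - 1) ≤ a / (a - 1) := by
    rw [div_le_div_iff₀ (by linarith) (by linarith)]; linarith
  rw [← div_div, ← div_div]
  exact div_le_div₀ (div_nonneg (by linarith) (by linarith)) h1 ht hty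

/-- Makes a whole range of log n a finite check: the small-prime product is worst at the right end,
while the large-prime factor and log log n are worst at the left. -/
theorem robinInequality_of_log_mem_Ico {n : ℕ} (hodd : Odd n) {a b : ℕ} {t P E : ℝ} (ha : 1 < a)
    (hlog : (a : ℝ) ≤ Real.log n) (hlog' : Real.log n < b) (ht0 : 0 < t) (ht : Real.exp t ≤ a)
    (hP : eulerProd ((Nat.primesLE (b - 1)).erase 2) ≤ P)
    (hE : Real.exp (a / ((a - 1) * t)) ≤ E) (hPE : P * E < 1.74 * t) : RobinInequality n := by
  have h0 : n ≠ 0 := by rintro rfl; simp at hodd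
  have hn : (0 : ℝ) < n := by positivity
  have ha' : (1 : ℝ) < a := by exact_mod_cast ha
  set y := Real.log n with hy
  have hty : t ≤ Real.log y :=
    (Real.le_log_iff_exp_le (by linarith)).2 (ht.trans hlog)
  have hpos : ∀ N : ℕ, ∀ p ∈ N.primesLE.erase 2, 2 ≤ p := fun N p hp =>
    (Nat.prime_of_mem_primesLE (Finset.mem_of_mem_erase hp)).two_le
  have hfl : ⌊y⌋₊ ≤ b - 1 := Nat.le_sub_one_of_lt ((Nat.floor_lt (by linarith)).2 hlog')
  have h1 : eulerProd n.primeFactors ≤ P * E := by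
    refine (eulerProd_primeFactors_le hodd (by linarith) hy).trans ?_
    refine mul_le_mul ?_ ?_ (Real.exp_pos _).le ((eulerProd_nonneg (hpos _)).trans hP)
    · exact (eulerProd_mono (Finset.erase_subset_erase 2 (Nat.primesLE_mono hfl)) (hpos _)).trans hP
    · exact (Real.exp_le_exp.2 (div_sub_one_mul_log_le ha' hlog ht0 hty)).trans hE
  refine robinInequality_of_le (Nat.pos_of_ne_zero h0) (s := P * E) (t := t) (u := y) ?_ ?_
    (ht.trans hlog) ht0.le hPE
  · exact (sigma_one_le_mul_eulerProd h0).trans (mul_le_mul_of_nonneg_right h1 hn.le)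
  · rw [hy, Real.exp_log hn]

theorem robinInequality_of_128_le_log {n : ℕ} (hodd : Odd n) (hlog : 128 ≤ Real.log n) :
    RobinInequality n := by
  have h0 : n ≠ 0 := by rintro rfl; simp at hodd
  have hn : (0 : ℝ) < n := by positivity
  set y := Real.log n with hy
  have hty : 4.85 ≤ Real.log y := by
    have h : Real.log 128 = 7 * Real.log 2 := by
      rw [show (128 : ℝ) = 2 ^ 7 by norm_num, Real.log_pow]; norm_num
    have := Real.log_le_log (by norm_num) hlog
    linarith [Real.log_two_gt_d9]
  have hfl : 128 ≤ ⌊y⌋₊ := Nat.le_floor (by exact_mod_cast hlog)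
  -- 1.33 · 1.25 = 1.6625 < 1.74; the factor 1.25 bounds e^(2/9), as 128/(127 · 4.85) < 2/9.
  have h1 : eulerProd n.primeFactors ≤ 1.33 * Real.log y * 1.25 := by
    refine (eulerProd_primeFactors_le hodd (by linarith) hy).trans ?_
    refine mul_le_mul ?_ ?_ (Real.exp_pos _).le (by linarith)
    · refine (eulerProd_erase_two_primesLE_le hfl).trans ?_
      have : (0 : ℝ) < ⌊y⌋₊ := by exact_mod_cast (by omega : 0 < ⌊y⌋₊)
      gcongr
      exact Nat.floor_le (by linarith)
    · refine (Real.exp_le_exp.2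
        (div_sub_one_mul_log_le (by norm_num) hlog (by norm_num) hty)).trans ?_
      refine le_trans (Real.exp_le_exp.2 ?_)
        (exp_div_le (a := 2) (b := 9) (by norm_num) (by norm_num) (by norm_num))
      norm_num
  refine robinInequality_of_le (Nat.pos_of_ne_zero h0) (s := 1.33 * Real.log y * 1.25)
    (t := Real.log y) (u := y) ?_ ?_ ?_ (by linarith) (by linarith)
  · exact (sigma_one_le_mul_eulerProd h0).trans (mul_le_mul_of_nonneg_right h1 hn.le)
  · rw [hy, Real.exp_log hn]
  · rw [Real.exp_log (by linarith)]

theorem robinInequality_of_ten_le_log {n : ℕ} (hodd : Odd n) (hlog : 10 ≤ Real.log n) :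
    RobinInequality n := by
  rcases le_or_gt 128 (Real.log n) with h128 | h128
  · exact robinInequality_of_128_le_log hodd h128
  rcases le_or_gt 41 (Real.log n) with h41 | h41
  · refine robinInequality_of_log_mem_Ico hodd (a := 41) (b := 128) (t := (37 : ℕ) / (10 : ℕ))
      (P := 4.392) (E := 1.34) (by norm_num) (by exact_mod_cast h41) (by exact_mod_cast h128)
      (by norm_num) (exp_div_le (by norm_num) (by norm_num) (by norm_num)) ?_ ?_ (by norm_num)
    · refine (eulerProd_mono (Finset.erase_subset_erase 2 (Nat.primesLE_mono (by norm_num)))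
        fun p hp => ?_).trans eulerProd_erase_two_primesLE_128
      exact (Nat.prime_of_mem_primesLE (Finset.mem_of_mem_erase hp)).two_le
    · refine le_trans (Real.exp_le_exp.2 ?_)
        (exp_div_le (a := 2) (b := 7) (by norm_num) (by norm_num) (by norm_num))
      norm_num
  rcases le_or_gt 19 (Real.log n) with h19 | h19
  · refine robinInequality_of_log_mem_Ico hodd (a := 19) (b := 41) (t := (29 : ℕ) / (10 : ℕ))
      (P := 3.37) (E := 1.46) (by norm_num) (by exact_mod_cast h19) (by exact_mod_cast h41)
      (by norm_num) (exp_div_le (by norm_num) (by norm_num) (by norm_num)) ?_ ?_ (by norm_num)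
    · rw [show (Nat.primesLE (41 - 1)).erase 2 = {3, 5, 7, 11, 13, 17, 19, 23, 29, 31, 37} by
        decide +kernel, eulerProd]
      norm_num
    · refine le_trans (Real.exp_le_exp.2 ?_)
        (exp_div_le (a := 3) (b := 8) (by norm_num) (by norm_num) (by norm_num))
      norm_num
  rcases le_or_gt 13 (Real.log n) with h13 | h13
  · refine robinInequality_of_log_mem_Ico hodd (a := 13) (b := 19) (t := (64 : ℕ) / (25 : ℕ))
      (P := 2.78) (E := 1.54) (by norm_num) (by exact_mod_cast h13) (by exact_mod_cast h19)
      (by norm_num) (exp_div_le (by norm_num) (by norm_num) (by norm_num)) ?_ ?_ (by norm_num)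
    · rw [show (Nat.primesLE (19 - 1)).erase 2 = {3, 5, 7, 11, 13, 17} by decide +kernel,
        eulerProd]
      norm_num
    · refine le_trans (Real.exp_le_exp.2 ?_)
        (exp_div_le (a := 3) (b := 7) (by norm_num) (by norm_num) (by norm_num))
      norm_num
  · refine robinInequality_of_log_mem_Ico hodd (a := 10) (b := 13) (t := (23 : ℕ) / (10 : ℕ))
      (P := 2.41) (E := 1.63) (by norm_num) (by exact_mod_cast hlog) (by exact_mod_cast h13)
      (by norm_num) (exp_div_le (by norm_num) (by norm_num) (by norm_num)) ?_ ?_ (by norm_num)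
    · rw [show (Nat.primesLE (13 - 1)).erase 2 = {3, 5, 7, 11} by decide +kernel, eulerProd]
      norm_num
    · refine le_trans (Real.exp_le_exp.2 ?_)
        (exp_div_le (a := 29) (b := 60) (by norm_num) (by norm_num) (by norm_num))
      norm_num

/-! ### Small n. -/

theorem robinInequality_of_log_lt_ten {n : ℕ} (hodd : Odd n) (hn : 21 ≤ n)
    (hlog : Real.log n < 10) : RobinInequality n := by
  have hn0 : (0 : ℝ) < n := by exact_mod_cast (by omega : 0 < n)
  obtain ⟨h1, h2⟩ := prod_and_eulerProd_of_odd _ n.primeFactors (fun p hp => by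
    have hp2 := (Nat.prime_of_mem_primeFactors hp).two_le
    have hpo : Odd p := hodd.of_dvd_nat (Nat.dvd_of_mem_primeFactors hp)
    exact ⟨hpo, by obtain ⟨k, rfl⟩ := hpo; omega⟩) rfl
  replace h1 := h1.trans (Nat.le_of_dvd (by omega) n.prod_primeFactors_dvd)
  -- 135135 = 3·5·7·9·11·13, so six odd prime factors are impossible.
  have hlt : n < 135135 := by
    have h : (n : ℝ) < Real.exp 10 := (Real.log_lt_iff_lt_exp hn0).1 hlog
    have h' : Real.exp ((10 : ℕ) / (1 : ℕ)) ≤ 135135 :=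
      exp_div_le (by norm_num) (by norm_num) (by norm_num)
    norm_num at h'
    exact_mod_cast h.trans_le h'
  have key : ∀ {s t : ℝ} {u m : ℕ}, eulerProd n.primeFactors ≤ s → m ≤ n →
      Real.exp ((u : ℕ) / (1 : ℕ)) ≤ m → Real.exp t ≤ u → 0 ≤ t → s < 1.74 * t →
      RobinInequality n := by
    intro s t u m hs hm hu ht ht0 hst
    refine robinInequality_of_le (by omega) (u := u)
      ((sigma_one_le_mul_eulerProd (by omega)).trans
        (mul_le_mul_of_nonneg_right hs hn0.le)) ?_ ht ht0 hst
    rw [Nat.cast_one, div_one] at hu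
    exact hu.trans (by exact_mod_cast hm)
  have hk : n.primeFactors.card < 6 := by
    by_contra! h
    have : ∏ i ∈ Finset.range 6, (2 * i + 3) ≤
        ∏ i ∈ Finset.range n.primeFactors.card, (2 * i + 3) :=
      Finset.prod_le_prod_of_subset_of_one_le' (Finset.range_subset_range.2 h)
        fun _ _ _ => by omega
    simp [Finset.prod_range_succ] at this
    omega
  set k := n.primeFactors.card
  -- 1.875 = (3/2)(5/4) covers at most two primes; the threshold 21 is the first integer above e³.
  have hle2 : ∀ s : ℝ, eulerProd n.primeFactors ≤ s → s ≤ 1.875 → RobinInequality n :=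
    fun s hs hs' => key (u := 3) (m := 21) (t := (27 : ℕ) / (25 : ℕ)) (hs.trans hs') hn
      (exp_div_le (by norm_num) (by norm_num) (by norm_num))
      (exp_div_le (by norm_num) (by norm_num) (by norm_num)) (by norm_num) (by norm_num)
  clear_value k
  interval_cases k
  · exact hle2 _ h2 (by norm_num)
  · exact hle2 _ h2 (by norm_num [Finset.prod_range_succ])
  · exact hle2 _ h2 (by norm_num [Finset.prod_range_succ])
  · exact key (u := 4) (m := 105) (t := (13 : ℕ) / (10 : ℕ)) h2
      (le_trans (by simp [Finset.prod_range_succ]) h1)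
      (exp_div_le (by norm_num) (by norm_num) (by norm_num))
      (exp_div_le (by norm_num) (by norm_num) (by norm_num)) (by norm_num)
      (by norm_num [Finset.prod_range_succ])
  · exact key (u := 6) (m := 945) (t := (8 : ℕ) / (5 : ℕ)) h2
      (le_trans (by simp [Finset.prod_range_succ]) h1)
      (exp_div_le (by norm_num) (by norm_num) (by norm_num))
      (exp_div_le (by norm_num) (by norm_num) (by norm_num)) (by norm_num)
      (by norm_num [Finset.prod_range_succ])
  · exact key (u := 6) (m := 945) (t := (8 : ℕ) / (5 : ℕ)) h2
      (le_trans (by simp [Finset.prod_range_succ]) h1)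
      (exp_div_le (by norm_num) (by norm_num) (by norm_num))
      (exp_div_le (by norm_num) (by norm_num) (by norm_num)) (by norm_num)
      (by norm_num [Finset.prod_range_succ])

theorem robinInequality_of_lt_twenty_one {n : ℕ} (hodd : Odd n) (hn : n < 21) (h1 : n ≠ 1)
    (h3 : n ≠ 3) (h5 : n ≠ 5) (h9 : n ≠ 9) : RobinInequality n := by
  -- For a prime m ≥ 11, σ(m)/m = 1 + 1/m ≤ 12/11; only 7 and 15 need separate constants.
  have key : ∀ m : ℕ, 11 ≤ m → 11 * ArithmeticFunction.sigma 1 m ≤ 12 * m →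
      RobinInequality m := by
    intro m hm hs
    have hs' : 11 * (ArithmeticFunction.sigma 1 m : ℝ) ≤ 12 * m := by exact_mod_cast hs
    refine robinInequality_of_le (s := 12 / 11) (t := (2 : ℕ) / (3 : ℕ)) (u := (2 : ℕ) / (1 : ℕ))
      (by omega) (by linarith) ?_ (exp_div_le (by norm_num) (by norm_num) (by norm_num))
      (by norm_num) (by norm_num)
    exact (exp_div_le (r := 11) (by norm_num) (by norm_num) (by norm_num)).trans
      (by exact_mod_cast hm)
  have h7 : ArithmeticFunction.sigma 1 7 = 8 := by decide +kernel
  have h15 : ArithmeticFunction.sigma 1 15 = 24 := by decide +kernel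
  interval_cases n <;> try contradiction
  · refine robinInequality_of_le (s := 8 / 7) (t := (33 : ℕ) / (50 : ℕ)) (u := (97 : ℕ) / (50 : ℕ))
      (by norm_num) (by rw [h7]; norm_num) (exp_div_le (by norm_num) (by norm_num) (by norm_num))
      (exp_div_le (by norm_num) (by norm_num) (by norm_num)) (by norm_num) (by norm_num)
  · exact key 11 (by norm_num) (by decide +kernel)
  · exact key 13 (by norm_num) (by decide +kernel)
  · refine robinInequality_of_le (s := 8 / 5) (t := (14 : ℕ) / (15 : ℕ)) (u := (13 : ℕ) / (5 : ℕ))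
      (by norm_num) (by rw [h15]; norm_num) (exp_div_le (by norm_num) (by norm_num) (by norm_num))
      (exp_div_le (by norm_num) (by norm_num) (by norm_num)) (by norm_num) (by norm_num)
  · exact key 17 (by norm_num) (by decide +kernel)
  · exact key 19 (by norm_num) (by decide +kernel)

theorem theorem2 (n : ℕ) (hodd : Odd n) (h1 : n ≠ 1) (h3 : n ≠ 3) (h5 : n ≠ 5) (h9 : n ≠ 9) :
    n ∈ robinSet := by
  refine ⟨hodd.pos, ?_⟩
  rcases lt_or_ge n 21 with hn | hn
  · exact robinInequality_of_lt_twenty_one hodd hn h1 h3 h5 h9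
  rcases lt_or_ge (Real.log n) 10 with hl | hl
  · exact robinInequality_of_log_lt_ten hodd hn hl
  · exact robinInequality_of_ten_le_log hodd hl
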